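/- Rings are associative, not necessarily with unity. A nonzero ring $R$ is prime if, for $a,b\in R$, $aRb=0$ implies $a=0$ or $b=0$. For a prime ring $R$, let $Q_s(R)$ be its Martindale symmetric ring of quotients, let $C$ be the extended centroid of $R$, that is, the center of $Q_s(R)$ (a field), and let $RC\subseteq Q_s(R)$ be the $C$-subspace spanned by $R$, which is a subring. The prime ring $R$ is called exceptional if $\operatorname{char} R=2$ and $\dim_C RC=4$. Write $[x,y]=xy-yx$. For additive subgroups $A,B$ of $Q_s(R)$ let $[A,B]$ be the additive subgroup generated by all $[x,y]$ with $x\in A$, $y\in B$. A Lie ideal of $RC$ is an additive subgroup $L\subseteq RC$ with $[L,RC]\subseteq L$. **Theorem.** Let $R$ be a noncommutative prime ring. Then the following are equivalent: (i) $Ca+C$ is a Lie ideal of $RC$ for every $a\in[RC,RC]\setminus C$; (ii) $R$ is exceptional. -/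

import Mathlib

/-- A (not necessarily unital) associative ring is *prime* if it is nonzero and `a R b = 0` implies
`a = 0` or `b = 0`. -/
class IsPrimeRing (R : Type*) [NonUnitalRing R] : Prop extends Nontrivial R where
  eq_zero_or_eq_zero : ∀ a b : R, (∀ r : R, a * r * b = 0) → a = 0 ∨ b = 0

namespace TwoSidedIdeal

/-- The product `I * I`: all finite sums of products of two elements of `I`. -/
def square {R : Type*} [NonUnitalRing R] (I : TwoSidedIdeal R) : TwoSidedIdeal R :=
  TwoSidedIdeal.mk' (AddSubgroup.closure {z : R | ∃ x ∈ I, ∃ y ∈ I, z = x * y})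
    (AddSubgroup.zero_mem _) (fun hx hy => AddSubgroup.add_mem _ hx hy) (fun hx => AddSubgroup.neg_mem _ hx)
    (fun {s z} hz => by
      refine AddSubgroup.closure_induction
        (p := fun z _ => s * z ∈ AddSubgroup.closure {z : R | ∃ x ∈ I, ∃ y ∈ I, z = x * y})
        ?_ ?_ ?_ ?_ hz
      · rintro _ ⟨x, hx, y, hy, rfl⟩
        exact AddSubgroup.subset_closure ⟨s * x, I.mul_mem_left _ _ hx, y, hy, by rw [mul_assoc]⟩
      · simp
      · intro u v _ _ hu hv
        rw [mul_add]; exact AddSubgroup.add_mem _ hu hv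
      · intro u _ hu
        rw [mul_neg]; exact AddSubgroup.neg_mem _ hu)
    (fun {z s} hz => by
      refine AddSubgroup.closure_induction
        (p := fun z _ => z * s ∈ AddSubgroup.closure {z : R | ∃ x ∈ I, ∃ y ∈ I, z = x * y})
        ?_ ?_ ?_ ?_ hz
      · rintro _ ⟨x, hx, y, hy, rfl⟩
        exact AddSubgroup.subset_closure ⟨x, hx, y * s, I.mul_mem_right _ _ hy, by rw [mul_assoc]⟩
      · simp
      · intro u v _ _ hu hv
        rw [add_mul]; exact AddSubgroup.add_mem _ hu hv
      · intro u _ hu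
        rw [neg_mul]; exact AddSubgroup.neg_mem _ hu)

theorem mem_square_iff {R : Type*} [NonUnitalRing R] (I : TwoSidedIdeal R) (z : R) :
    z ∈ I.square ↔ z ∈ AddSubgroup.closure {z : R | ∃ x ∈ I, ∃ y ∈ I, z = x * y} := by
  unfold square
  rw [TwoSidedIdeal.mem_mk']
  rfl

theorem mul_mem_square {R : Type*} [NonUnitalRing R] (I : TwoSidedIdeal R) {x y : R}
    (hx : x ∈ I) (hy : y ∈ I) : x * y ∈ I.square :=
  (I.mem_square_iff _).2 (AddSubgroup.subset_closure ⟨x, hx, y, hy, rfl⟩)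

theorem square_le {R : Type*} [NonUnitalRing R] (I : TwoSidedIdeal R) : I.square ≤ I := by
  intro z hz
  refine AddSubgroup.closure_induction (p := fun z _ => z ∈ I) ?_ ?_ ?_ ?_
    ((I.mem_square_iff _).1 hz)
  · rintro _ ⟨x, _, y, hy, rfl⟩
    exact I.mul_mem_left _ _ hy
  · exact I.zero_mem
  · intro u v _ _ hu hv
    exact I.add_mem hu hv
  · intro u _ hu
    exact I.neg_mem hu

theorem exists_ne_zero_of_ne_bot {R : Type*} [NonUnitalRing R] {I : TwoSidedIdeal R}
    (hI : I ≠ ⊥) : ∃ x ∈ I, x ≠ 0 := by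
  by_contra! h
  exact hI (le_bot_iff.1 fun x hx => (TwoSidedIdeal.mem_bot R).2 (h x hx))

theorem ne_bot_of_mem {R : Type*} [NonUnitalRing R] {I : TwoSidedIdeal R} {x : R}
    (hx : x ∈ I) (h : x ≠ 0) : I ≠ ⊥ := by
  rintro rfl
  exact h ((TwoSidedIdeal.mem_bot R).1 hx)

theorem square_ne_bot {R : Type*} [NonUnitalRing R] [IsPrimeRing R] {I : TwoSidedIdeal R}
    (hI : I ≠ ⊥) : I.square ≠ ⊥ := by
  obtain ⟨x, hx, h0⟩ := exists_ne_zero_of_ne_bot hI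
  have : ∃ r, x * r * x ≠ 0 := by
    by_contra! h
    rcases IsPrimeRing.eq_zero_or_eq_zero x x h with h | h <;> exact h0 h
  obtain ⟨r, hr⟩ := this
  exact ne_bot_of_mem (I.mul_mem_square (I.mul_mem_right _ _ hx) hx) hr

theorem inf_ne_bot {R : Type*} [NonUnitalRing R] [IsPrimeRing R] {I J : TwoSidedIdeal R}
    (hI : I ≠ ⊥) (hJ : J ≠ ⊥) : I ⊓ J ≠ ⊥ := by
  obtain ⟨x, hx, hx0⟩ := exists_ne_zero_of_ne_bot hI
  obtain ⟨y, hy, hy0⟩ := exists_ne_zero_of_ne_bot hJ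
  have : ∃ r, x * r * y ≠ 0 := by
    by_contra! h
    rcases IsPrimeRing.eq_zero_or_eq_zero x y h with h | h
    exacts [hx0 h, hy0 h]
  obtain ⟨r, hr⟩ := this
  refine ne_bot_of_mem (x := x * r * y) ?_ hr
  rw [TwoSidedIdeal.mem_inf]
  exact ⟨I.mul_mem_right _ _ (I.mul_mem_right _ _ hx), J.mul_mem_left _ _ hy⟩

end TwoSidedIdeal

namespace PrimeRing

/-- A balanced pair on a nonzero ideal `dom` of `R`: a right `R`-module map `l : dom → R`
("multiplication by `q` from the left", `y ↦ q y`) and a left `R`-module map `r : dom → R`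
("multiplication by `q` from the right", `x ↦ x q`), with `x (q y) = (x q) y`.
The maps are stored as functions on all of `R`; their values outside `dom` carry no information. -/
structure BalancedPair (R : Type*) [NonUnitalRing R] where
  dom : TwoSidedIdeal R
  dom_ne_bot : dom ≠ ⊥
  l : R → R
  r : R → R
  l_add : ∀ x ∈ dom, ∀ y ∈ dom, l (x + y) = l x + l y
  l_mul : ∀ x ∈ dom, ∀ s : R, l (x * s) = l x * s
  r_add : ∀ x ∈ dom, ∀ y ∈ dom, r (x + y) = r x + r y
  r_mul : ∀ x ∈ dom, ∀ s : R, r (s * x) = s * r x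
  balanced : ∀ x ∈ dom, ∀ y ∈ dom, x * l y = r x * y

namespace BalancedPair

/-- Two balanced pairs are equivalent if they agree on a nonzero ideal contained in both domains. -/
def Rel {R : Type*} [NonUnitalRing R] (p q : BalancedPair R) : Prop :=
  ∃ K : TwoSidedIdeal R, K ≠ ⊥ ∧ K ≤ p.dom ∧ K ≤ q.dom ∧
    ∀ x ∈ K, p.l x = q.l x ∧ p.r x = q.r x

instance setoid (R : Type*) [NonUnitalRing R] [IsPrimeRing R] : Setoid (BalancedPair R) where
  r := Rel
  iseqv :=
    { refl := fun p => ⟨p.dom, p.dom_ne_bot, le_rfl, le_rfl, fun _ _ => ⟨rfl, rfl⟩⟩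
      symm := fun ⟨K, h0, h1, h2, h⟩ =>
        ⟨K, h0, h2, h1, fun x hx => ⟨(h x hx).1.symm, (h x hx).2.symm⟩⟩
      trans := fun ⟨K, h0, h1, _, h⟩ ⟨K', h0', _, h2', h'⟩ =>
        ⟨K ⊓ K', TwoSidedIdeal.inf_ne_bot h0 h0', inf_le_left.trans h1, inf_le_right.trans h2',
          fun x hx =>
            have hx' := (TwoSidedIdeal.mem_inf R).1 hx
            ⟨(h x hx'.1).1.trans (h' x hx'.2).1, (h x hx'.1).2.trans (h' x hx'.2).2⟩⟩ }

variable {R : Type*} [NonUnitalRing R]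

theorem l_zero (p : BalancedPair R) : p.l 0 = 0 := by
  have h := p.l_add 0 p.dom.zero_mem 0 p.dom.zero_mem
  rw [add_zero] at h
  exact left_eq_add.1 h

theorem r_zero (p : BalancedPair R) : p.r 0 = 0 := by
  have h := p.r_add 0 p.dom.zero_mem 0 p.dom.zero_mem
  rw [add_zero] at h
  exact left_eq_add.1 h

theorem l_neg (p : BalancedPair R) {x : R} (hx : x ∈ p.dom) : p.l (-x) = -p.l x := by
  have h := p.l_add x hx (-x) (p.dom.neg_mem hx)
  rw [add_neg_cancel, l_zero] at h
  exact (neg_eq_of_add_eq_zero_right h.symm).symm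

theorem r_neg (p : BalancedPair R) {x : R} (hx : x ∈ p.dom) : p.r (-x) = -p.r x := by
  have h := p.r_add x hx (-x) (p.dom.neg_mem hx)
  rw [add_neg_cancel, r_zero] at h
  exact (neg_eq_of_add_eq_zero_right h.symm).symm

theorem l_mem_of_mem_square (p : BalancedPair R) {J : TwoSidedIdeal R} (hJ : J ≤ p.dom) {z : R}
    (hz : z ∈ J.square) : p.l z ∈ J := by
  have key : z ∈ J ∧ p.l z ∈ J := by
    refine AddSubgroup.closure_induction (p := fun z _ => z ∈ J ∧ p.l z ∈ J) ?_ ?_ ?_ ?_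
      ((J.mem_square_iff _).1 hz)
    · rintro _ ⟨x, hx, y, hy, rfl⟩
      refine ⟨J.mul_mem_left _ _ hy, ?_⟩
      rw [p.l_mul x (hJ hx)]
      exact J.mul_mem_left _ _ hy
    · exact ⟨J.zero_mem, by rw [l_zero]; exact J.zero_mem⟩
    · rintro u v _ _ ⟨hu, hu'⟩ ⟨hv, hv'⟩
      refine ⟨J.add_mem hu hv, ?_⟩
      rw [p.l_add u (hJ hu) v (hJ hv)]
      exact J.add_mem hu' hv'
    · rintro u _ ⟨hu, hu'⟩
      refine ⟨J.neg_mem hu, ?_⟩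
      rw [p.l_neg (hJ hu)]
      exact J.neg_mem hu'
  exact key.2

theorem r_mem_of_mem_square (p : BalancedPair R) {J : TwoSidedIdeal R} (hJ : J ≤ p.dom) {z : R}
    (hz : z ∈ J.square) : p.r z ∈ J := by
  have key : z ∈ J ∧ p.r z ∈ J := by
    refine AddSubgroup.closure_induction (p := fun z _ => z ∈ J ∧ p.r z ∈ J) ?_ ?_ ?_ ?_
      ((J.mem_square_iff _).1 hz)
    · rintro _ ⟨x, hx, y, hy, rfl⟩
      refine ⟨J.mul_mem_left _ _ hy, ?_⟩
      rw [p.r_mul y (hJ hy)]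
      exact J.mul_mem_right _ _ hx
    · exact ⟨J.zero_mem, by rw [r_zero]; exact J.zero_mem⟩
    · rintro u v _ _ ⟨hu, hu'⟩ ⟨hv, hv'⟩
      refine ⟨J.add_mem hu hv, ?_⟩
      rw [p.r_add u (hJ hu) v (hJ hv)]
      exact J.add_mem hu' hv'
    · rintro u _ ⟨hu, hu'⟩
      refine ⟨J.neg_mem hu, ?_⟩
      rw [p.r_neg (hJ hu)]
      exact J.neg_mem hu'
  exact key.2

/-- Multiplication by an element `a` of `R`. -/
def ofElem [IsPrimeRing R] (a : R) : BalancedPair R where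
  dom := ⊤
  dom_ne_bot := by
    obtain ⟨x, hx⟩ := exists_ne (0 : R)
    exact TwoSidedIdeal.ne_bot_of_mem (TwoSidedIdeal.mem_top R) hx
  l := fun y => a * y
  r := fun x => x * a
  l_add := fun _ _ _ _ => mul_add _ _ _
  l_mul := fun _ _ _ => (mul_assoc _ _ _).symm
  r_add := fun _ _ _ _ => add_mul _ _ _
  r_mul := fun _ _ _ => mul_assoc _ _ _
  balanced := fun _ _ _ _ => (mul_assoc _ _ _).symm

/-- The identity pair. -/
def one [IsPrimeRing R] : BalancedPair R where
  dom := ⊤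
  dom_ne_bot := (ofElem (0 : R)).dom_ne_bot
  l := fun y => y
  r := fun x => x
  l_add := fun _ _ _ _ => rfl
  l_mul := fun _ _ _ => rfl
  r_add := fun _ _ _ _ => rfl
  r_mul := fun _ _ _ => rfl
  balanced := fun _ _ _ _ => rfl

/-- Pointwise sum, on the intersection of the domains. -/
def add [IsPrimeRing R] (p q : BalancedPair R) : BalancedPair R where
  dom := p.dom ⊓ q.dom
  dom_ne_bot := TwoSidedIdeal.inf_ne_bot p.dom_ne_bot q.dom_ne_bot
  l := fun y => p.l y + q.l y
  r := fun x => p.r x + q.r x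
  l_add := fun x hx y hy => by
    rw [TwoSidedIdeal.mem_inf] at hx hy
    rw [p.l_add x hx.1 y hy.1, q.l_add x hx.2 y hy.2, add_add_add_comm]
  l_mul := fun x hx s => by
    rw [TwoSidedIdeal.mem_inf] at hx
    rw [p.l_mul x hx.1, q.l_mul x hx.2, add_mul]
  r_add := fun x hx y hy => by
    rw [TwoSidedIdeal.mem_inf] at hx hy
    rw [p.r_add x hx.1 y hy.1, q.r_add x hx.2 y hy.2, add_add_add_comm]
  r_mul := fun x hx s => by
    rw [TwoSidedIdeal.mem_inf] at hx
    rw [p.r_mul x hx.1, q.r_mul x hx.2, mul_add]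
  balanced := fun x hx y hy => by
    rw [TwoSidedIdeal.mem_inf] at hx hy
    rw [mul_add, add_mul, p.balanced x hx.1 y hy.1, q.balanced x hx.2 y hy.2]

/-- Pointwise negation. -/
def neg (p : BalancedPair R) : BalancedPair R where
  dom := p.dom
  dom_ne_bot := p.dom_ne_bot
  l := fun y => -p.l y
  r := fun x => -p.r x
  l_add := fun x hx y hy => by rw [p.l_add x hx y hy, neg_add]
  l_mul := fun x hx s => by rw [p.l_mul x hx, neg_mul]
  r_add := fun x hx y hy => by rw [p.r_add x hx y hy, neg_add]
  r_mul := fun x hx s => by rw [p.r_mul x hx, mul_neg]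
  balanced := fun x hx y hy => by rw [mul_neg, neg_mul, p.balanced x hx y hy]

/-- Composition: `y ↦ p (q y)` and `x ↦ (x p) q`, on the square of the intersection of the
domains. -/
def mul [IsPrimeRing R] (p q : BalancedPair R) : BalancedPair R where
  dom := (p.dom ⊓ q.dom).square
  dom_ne_bot := TwoSidedIdeal.square_ne_bot
    (TwoSidedIdeal.inf_ne_bot p.dom_ne_bot q.dom_ne_bot)
  l := fun y => p.l (q.l y)
  r := fun x => q.r (p.r x)
  l_add := fun x hx y hy => by
    rw [q.l_add x (inf_le_right (a := p.dom) (TwoSidedIdeal.square_le _ hx))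
        y (inf_le_right (a := p.dom) (TwoSidedIdeal.square_le _ hy)),
      p.l_add _ (inf_le_left (b := q.dom) (q.l_mem_of_mem_square inf_le_right hx))
        _ (inf_le_left (b := q.dom) (q.l_mem_of_mem_square inf_le_right hy))]
  l_mul := fun x hx s => by
    rw [q.l_mul x (inf_le_right (a := p.dom) (TwoSidedIdeal.square_le _ hx)),
      p.l_mul _ (inf_le_left (b := q.dom) (q.l_mem_of_mem_square inf_le_right hx))]
  r_add := fun x hx y hy => by
    rw [p.r_add x (inf_le_left (b := q.dom) (TwoSidedIdeal.square_le _ hx))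
        y (inf_le_left (b := q.dom) (TwoSidedIdeal.square_le _ hy)),
      q.r_add _ (inf_le_right (a := p.dom) (p.r_mem_of_mem_square inf_le_left hx))
        _ (inf_le_right (a := p.dom) (p.r_mem_of_mem_square inf_le_left hy))]
  r_mul := fun x hx s => by
    rw [p.r_mul x (inf_le_left (b := q.dom) (TwoSidedIdeal.square_le _ hx)),
      q.r_mul _ (inf_le_right (a := p.dom) (p.r_mem_of_mem_square inf_le_left hx))]
  balanced := fun x hx y hy => by
    rw [p.balanced x (inf_le_left (b := q.dom) (TwoSidedIdeal.square_le _ hx))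
        _ (inf_le_left (b := q.dom) (q.l_mem_of_mem_square inf_le_right hy)),
      q.balanced _ (inf_le_right (a := p.dom) (p.r_mem_of_mem_square inf_le_left hx))
        y (inf_le_right (a := p.dom) (TwoSidedIdeal.square_le _ hy))]

theorem equiv_of_eq_on [IsPrimeRing R] (p q : BalancedPair R)
    (h : ∀ x ∈ p.dom ⊓ q.dom, p.l x = q.l x ∧ p.r x = q.r x) : p ≈ q :=
  ⟨p.dom ⊓ q.dom, TwoSidedIdeal.inf_ne_bot p.dom_ne_bot q.dom_ne_bot,
    inf_le_left, inf_le_right, h⟩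

theorem add_congr [IsPrimeRing R] {p p' q q' : BalancedPair R} (hp : p ≈ p') (hq : q ≈ q') :
    add p q ≈ add p' q' := by
  obtain ⟨K, h0, h1, h2, h⟩ := hp
  obtain ⟨K', h0', h1', h2', h'⟩ := hq
  refine ⟨K ⊓ K', TwoSidedIdeal.inf_ne_bot h0 h0', inf_le_inf h1 h1', inf_le_inf h2 h2', ?_⟩
  intro x hx
  rw [TwoSidedIdeal.mem_inf] at hx
  simp only [add]
  rw [(h x hx.1).1, (h x hx.1).2, (h' x hx.2).1, (h' x hx.2).2]
  exact ⟨rfl, rfl⟩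

theorem neg_congr [IsPrimeRing R] {p p' : BalancedPair R} (hp : p ≈ p') : neg p ≈ neg p' := by
  obtain ⟨K, h0, h1, h2, h⟩ := hp
  refine ⟨K, h0, h1, h2, fun x hx => ?_⟩
  simp only [neg]
  rw [(h x hx).1, (h x hx).2]
  exact ⟨rfl, rfl⟩

theorem square_mono {I J : TwoSidedIdeal R} (h : I ≤ J) : I.square ≤ J.square := by
  intro z hz
  rw [TwoSidedIdeal.mem_square_iff] at hz ⊢
  refine AddSubgroup.closure_mono ?_ hz
  rintro _ ⟨x, hx, y, hy, rfl⟩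
  exact ⟨x, h hx, y, h hy, rfl⟩

theorem mul_congr [IsPrimeRing R] {p p' q q' : BalancedPair R} (hp : p ≈ p') (hq : q ≈ q') :
    mul p q ≈ mul p' q' := by
  obtain ⟨K, h0, h1, h2, h⟩ := hp
  obtain ⟨K', h0', h1', h2', h'⟩ := hq
  refine ⟨(K ⊓ K').square, TwoSidedIdeal.square_ne_bot (TwoSidedIdeal.inf_ne_bot h0 h0'),
    square_mono (inf_le_inf h1 h1'), square_mono (inf_le_inf h2 h2'), ?_⟩
  intro x hx
  have hx' := (TwoSidedIdeal.mem_inf R).1 (TwoSidedIdeal.square_le _ hx)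
  have hl := (TwoSidedIdeal.mem_inf R).1
    (q.l_mem_of_mem_square (J := K ⊓ K') (inf_le_right.trans h1') hx)
  have hr := (TwoSidedIdeal.mem_inf R).1
    (p.r_mem_of_mem_square (J := K ⊓ K') (inf_le_left.trans h1) hx)
  constructor
  · change p.l (q.l x) = p'.l (q'.l x)
    rw [← (h' x hx'.2).1, (h _ hl.1).1]
  · change q.r (p.r x) = q'.r (p'.r x)
    rw [← (h x hx'.1).2, (h' _ hr.2).2]

end BalancedPair

/-- The Martindale symmetric ring of quotients `Q_s(R)` of a prime ring `R`. -/
def SymmQuot (R : Type*) [NonUnitalRing R] [IsPrimeRing R] : Type _ :=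
  Quotient (BalancedPair.setoid R)

namespace SymmQuot

section Operations

variable (R : Type*) [NonUnitalRing R] [IsPrimeRing R]

instance instAdd : Add (SymmQuot R) :=
  ⟨Quotient.map₂ BalancedPair.add fun _ _ hp _ _ hq => BalancedPair.add_congr hp hq⟩

instance instZero : Zero (SymmQuot R) := ⟨Quotient.mk _ (BalancedPair.ofElem 0)⟩

instance instNeg : Neg (SymmQuot R) :=
  ⟨Quotient.map BalancedPair.neg fun _ _ hp => BalancedPair.neg_congr hp⟩

instance instMul : Mul (SymmQuot R) :=
  ⟨Quotient.map₂ BalancedPair.mul fun _ _ hp _ _ hq => BalancedPair.mul_congr hp hq⟩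

instance instOne : One (SymmQuot R) := ⟨Quotient.mk _ BalancedPair.one⟩

end Operations

instance instRing (R : Type*) [NonUnitalRing R] [IsPrimeRing R] : Ring (SymmQuot R) where
  nsmul := nsmulRec
  zsmul := zsmulRec
  add_assoc := by
    rintro ⟨p⟩ ⟨q⟩ ⟨s⟩
    exact Quotient.sound (BalancedPair.equiv_of_eq_on _ _ fun x _ =>
      ⟨add_assoc _ _ _, add_assoc _ _ _⟩)
  zero_add := by
    rintro ⟨p⟩
    refine Quotient.sound (BalancedPair.equiv_of_eq_on _ _ fun x _ => ?_)
    simp [BalancedPair.add, BalancedPair.ofElem]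
  add_zero := by
    rintro ⟨p⟩
    refine Quotient.sound (BalancedPair.equiv_of_eq_on _ _ fun x _ => ?_)
    simp [BalancedPair.add, BalancedPair.ofElem]
  add_comm := by
    rintro ⟨p⟩ ⟨q⟩
    exact Quotient.sound (BalancedPair.equiv_of_eq_on _ _ fun x _ =>
      ⟨add_comm _ _, add_comm _ _⟩)
  neg_add_cancel := by
    rintro ⟨p⟩
    refine Quotient.sound (BalancedPair.equiv_of_eq_on _ _ fun x _ => ?_)
    simp [BalancedPair.add, BalancedPair.neg, BalancedPair.ofElem]
  mul_assoc := by
    rintro ⟨p⟩ ⟨q⟩ ⟨s⟩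
    exact Quotient.sound (BalancedPair.equiv_of_eq_on _ _ fun x _ => ⟨rfl, rfl⟩)
  one_mul := by
    rintro ⟨p⟩
    exact Quotient.sound (BalancedPair.equiv_of_eq_on _ _ fun x _ => ⟨rfl, rfl⟩)
  mul_one := by
    rintro ⟨p⟩
    exact Quotient.sound (BalancedPair.equiv_of_eq_on _ _ fun x _ => ⟨rfl, rfl⟩)
  zero_mul := by
    rintro ⟨p⟩
    refine Quotient.sound (BalancedPair.equiv_of_eq_on _ _ fun x _ => ?_)
    simp [BalancedPair.mul, BalancedPair.ofElem, p.r_zero]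
  mul_zero := by
    rintro ⟨p⟩
    refine Quotient.sound (BalancedPair.equiv_of_eq_on _ _ fun x _ => ?_)
    simp [BalancedPair.mul, BalancedPair.ofElem, p.l_zero]
  left_distrib := by
    rintro ⟨p⟩ ⟨q⟩ ⟨s⟩
    refine Quotient.sound (BalancedPair.equiv_of_eq_on _ _ fun x hx => ?_)
    have hx := ((TwoSidedIdeal.mem_inf R).1
      ((TwoSidedIdeal.mem_inf R).1 hx).2)
    have hq := (TwoSidedIdeal.mem_inf R).1 (q.l_mem_of_mem_square inf_le_right hx.1)
    have hs := (TwoSidedIdeal.mem_inf R).1 (s.l_mem_of_mem_square inf_le_right hx.2)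
    exact ⟨p.l_add _ hq.1 _ hs.1, rfl⟩
  right_distrib := by
    rintro ⟨p⟩ ⟨q⟩ ⟨s⟩
    refine Quotient.sound (BalancedPair.equiv_of_eq_on _ _ fun x hx => ?_)
    have hx := ((TwoSidedIdeal.mem_inf R).1
      ((TwoSidedIdeal.mem_inf R).1 hx).2)
    have hp := (TwoSidedIdeal.mem_inf R).1 (p.r_mem_of_mem_square inf_le_left hx.1)
    have hq := (TwoSidedIdeal.mem_inf R).1 (q.r_mem_of_mem_square inf_le_left hx.2)
    exact ⟨rfl, s.r_add _ hp.2 _ hq.2⟩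

/-- The canonical ring homomorphism `R → Q_s(R)`, `a ↦` (multiplication by `a`). -/
def ofRing (R : Type*) [NonUnitalRing R] [IsPrimeRing R] : R →ₙ+* SymmQuot R where
  toFun a := Quotient.mk _ (BalancedPair.ofElem a)
  map_zero' := rfl
  map_add' _ _ := Quotient.sound (BalancedPair.equiv_of_eq_on _ _ fun _ _ =>
    ⟨add_mul _ _ _, mul_add _ _ _⟩)
  map_mul' _ _ := Quotient.sound (BalancedPair.equiv_of_eq_on _ _ fun _ _ =>
    ⟨mul_assoc _ _ _, (mul_assoc _ _ _).symm⟩)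

end SymmQuot

/-- The extended centroid `C` of `R`: the center of `Q_s(R)`. -/
abbrev ExtCentroid (R : Type*) [NonUnitalRing R] [IsPrimeRing R] : Subring (SymmQuot R) :=
  Subring.center (SymmQuot R)

/-- `RC`, as a `C`-subspace of `Q_s(R)`: all finite sums of products `r c`. -/
def centralClosure (R : Type*) [NonUnitalRing R] [IsPrimeRing R] :
    Submodule (ExtCentroid R) (SymmQuot R) :=
  Submodule.span (ExtCentroid R) (Set.range (SymmQuot.ofRing R))

/-- `char R = 2` (for rings possibly without unity: `2` is the least `n > 0` with `n R = 0`) and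
`dim_C RC = 4`. -/
def IsExceptional (R : Type*) [NonUnitalRing R] [IsPrimeRing R] : Prop :=
  AddMonoid.exponent R = 2 ∧ Module.finrank (ExtCentroid R) (centralClosure R) = 4

/-- `[A, B]`: the additive subgroup generated by all `a b - b a` with `a ∈ A`, `b ∈ B`. -/
def commutator {Q : Type*} [Ring Q] (A B : AddSubgroup Q) : AddSubgroup Q :=
  AddSubgroup.closure {x : Q | ∃ a ∈ A, ∃ b ∈ B, x = a * b - b * a}

/-- `L` is a Lie ideal of `S` (additive subgroups of `Q`; used for `S` closed under
multiplication): `L` is contained in `S` and `[L, S] ⊆ L`. -/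
def IsLieIdealOf {Q : Type*} [Ring Q] (L S : AddSubgroup Q) : Prop :=
  L ≤ S ∧ commutator L S ≤ L

/-- The additive subgroup `Ca + C` of `Q_s(R)`. -/
def affineLine {R : Type*} [NonUnitalRing R] [IsPrimeRing R] (a : SymmQuot R) :
    AddSubgroup (SymmQuot R) :=
  (Submodule.span (ExtCentroid R) {a} ⊔ Submodule.span (ExtCentroid R) {1}).toAddSubgroup

end PrimeRing

/-!
Pass from `RC` to the unital algebra `B = RC + C`: by Martindale's theory `C` is a field and `B` is
a prime central `C`-algebra with the same commutators as `RC`. If `dim_C RC` is finite, then `B` is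
prime Artinian, hence simple, and its nonzero ideal `RC` contains `1`. In both directions one may
therefore assume `RC = B`, and (i) says that `⁅a, ·⁆` maps `B` into `Ca + C` for every noncentral
`a ∈ [B, B]`.

* Suppose (i). Every noncentral `a ∈ [B, B]` satisfies `⁅a, ⁅a, x⁆⁆ = 0`, which in a prime ring
  forces characteristic two. Some noncentral commutator `b` has `⁅b, x⁆ = b` and `⁅b, y⁆ = 1`, so
  `⁅b, ·⁆` has range `Cb + C`. If `⁅b, z⁆ = 0`, then `z = ⁅b, z * y⁆` lies in the range, so
  the kernel is `Cb + C` too, and `B` has dimension `2 + 2`.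
* Suppose that `B` has characteristic two and dimension four. The centralizer of a noncentral `a`
  is then `Ca + C`. Elements of `[B, B]` have central squares, so `⁅a, ⁅a, x⁆⁆ = ⁅a * a, x⁆ = 0`
  puts `⁅a, x⁆` into that centralizer.
-/

namespace IsPrimeRing

section NonUnital

variable {R : Type*} [NonUnitalRing R] [IsPrimeRing R] {I : TwoSidedIdeal R} {a : R}

theorem eq_zero_of_forall_mul_eq_zero (hI : I ≠ ⊥) (h : ∀ x ∈ I, a * x = 0) : a = 0 := by
  obtain ⟨x, hx, hx0⟩ := TwoSidedIdeal.exists_ne_zero_of_ne_bot hI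
  refine (eq_zero_or_eq_zero a x fun r => ?_).resolve_right hx0
  rw [mul_assoc, h _ (I.mul_mem_left _ _ hx)]

theorem eq_zero_of_forall_mul_eq_zero' (hI : I ≠ ⊥) (h : ∀ x ∈ I, x * a = 0) : a = 0 := by
  obtain ⟨x, hx, hx0⟩ := TwoSidedIdeal.exists_ne_zero_of_ne_bot hI
  exact (eq_zero_or_eq_zero x a fun r => h _ (I.mul_mem_right _ _ hx)).resolve_left hx0

end NonUnital

section Artinian

variable {B : Type*} [Ring B] [IsPrimeRing B] [IsArtinianRing B]

theorem isSemisimpleRing_of_isArtinianRing : IsSemisimpleRing B := by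
  refine IsArtinianRing.isSemisimpleRing_iff_jacobson.2 ((Submodule.eq_bot_iff _).2 fun j hj => ?_)
  obtain ⟨L, hL, -⟩ := (eq_bot_or_exists_atom_le (⊤ : Ideal B)).resolve_left top_ne_bot
  have : IsSimpleModule B L := isSimpleModule_iff_isAtom.2 hL
  obtain ⟨x, hx, hx0⟩ := (Submodule.ne_bot_iff L).1 hL.1
  refine (IsPrimeRing.eq_zero_or_eq_zero j x fun r => ?_).resolve_right hx0
  have hann := IsSemisimpleModule.jacobson_le_annihilator B L hj
  have := Module.mem_annihilator.1 hann (r • ⟨x, hx⟩)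
  simpa [mul_assoc] using congrArg Subtype.val this

theorem eq_top_of_isTwoSided {I : Ideal B} [I.IsTwoSided] (hI : I ≠ ⊥) : I = ⊤ := by
  have := isSemisimpleRing_of_isArtinianRing (B := B)
  obtain ⟨N, hN⟩ := exists_isCompl I
  obtain ⟨x, hx, hx0⟩ := (Submodule.ne_bot_iff I).1 hI
  have hN0 : N = ⊥ := (Submodule.eq_bot_iff N).2 fun y hy =>
    (IsPrimeRing.eq_zero_or_eq_zero x y fun r => Submodule.disjoint_def.1 hN.disjoint _
      (I.mul_mem_right y (I.mul_mem_right r hx)) (N.mul_mem_left (x * r) hy)).resolve_left hx0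
  rw [← hN.sup_eq_top, hN0, sup_bot_eq]

end Artinian

end IsPrimeRing

namespace PrimeRing

section LieBracket

attribute [local instance] LieRing.ofAssociativeRing

section Bracket

variable {B : Type*} [Ring B]

theorem lie_mul (a x y : B) : ⁅a, x * y⁆ = ⁅a, x⁆ * y + x * ⁅a, y⁆ := by
  simp only [Ring.lie_def]
  noncomm_ring

theorem lie_self_mul (a x : B) : ⁅a, a * x⁆ = a * ⁅a, x⁆ := by
  rw [lie_mul, lie_self, zero_mul, zero_add]

theorem lie_lie_self_eq_lie_mul_self [CharP B 2] (a x : B) : ⁅a, ⁅a, x⁆⁆ = ⁅a * a, x⁆ := by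
  have hexpand : ⁅a, ⁅a, x⁆⁆ = ⁅a * a, x⁆ + (⁅x, a⁆ * a + ⁅x, a⁆ * a) := by
    simp only [Ring.lie_def]
    noncomm_ring
  rw [hexpand, CharTwo.add_self_eq_zero, add_zero]

theorem lie_eq_zero_of_forall_lie_lie_eq_zero [IsPrimeRing B] (h2 : (2 : B) ≠ 0) {a : B}
    (ha : ∀ x : B, ⁅a, ⁅a, x⁆⁆ = 0) (x : B) : ⁅a, x⁆ = 0 := by
  have hmul (y z : B) : ⁅a, y⁆ * ⁅a, z⁆ = 0 := by
    have hdouble : 2 * (⁅a, y⁆ * ⁅a, z⁆) = 0 := by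
      simpa only [lie_mul, lie_add, ha, zero_mul, mul_zero, zero_add, add_zero, two_mul]
        using ha (y * z)
    refine (IsPrimeRing.eq_zero_or_eq_zero 2 _ fun r => ?_).resolve_left h2
    rw [two_mul, ← mul_two, mul_assoc, hdouble, mul_zero]
  have hsandwich (r : B) : ⁅a, x⁆ * r * ⁅a, x⁆ = 0 := by
    simpa [lie_mul, mul_add, ← mul_assoc, hmul] using hmul x (r * x)
  exact or_self_iff.1 (IsPrimeRing.eq_zero_or_eq_zero _ _ hsandwich)

theorem lie_mem_commutator_top (x y : B) : ⁅x, y⁆ ∈ commutator (⊤ : AddSubgroup B) ⊤ :=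
  AddSubgroup.subset_closure ⟨x, trivial, y, trivial, rfl⟩

end Bracket

section Algebra

variable {F B : Type*} [CommRing F] [Ring B] [Algebra F B]

theorem lie_eq_zero_of_mem_bot {a : B} (ha : a ∈ (⊥ : Subalgebra F B)) (x : B) : ⁅a, x⁆ = 0 := by
  obtain ⟨c, rfl⟩ := Algebra.mem_bot.1 ha
  exact commute_iff_lie_eq.1 (Algebra.commutes c x)

theorem mem_bot_iff_forall_lie_eq_zero [Algebra.IsCentral F B] {a : B} :
    a ∈ (⊥ : Subalgebra F B) ↔ ∀ x : B, ⁅a, x⁆ = 0 := by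
  refine ⟨lie_eq_zero_of_mem_bot, fun h => Algebra.IsCentral.out ?_⟩
  exact Subalgebra.mem_center_iff.2 fun x => (commute_iff_lie_eq.2 (h x)).symm

theorem smul_add_smul_one_lie (c d : F) (a x : B) : ⁅c • a + d • 1, x⁆ = c • ⁅a, x⁆ := by
  rw [add_lie, smul_lie, smul_lie, commute_iff_lie_eq.1 (Commute.one_left x), smul_zero, add_zero]

theorem lie_smul_add_smul_one (c d : F) (x a : B) : ⁅x, c • a + d • 1⁆ = c • ⁅x, a⁆ := by
  rw [lie_add, lie_smul c, lie_smul d, commute_iff_lie_eq.1 (Commute.one_right x), smul_zero,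
    add_zero]

theorem lie_eq_zero_of_mem_span_pair_one {a z : B} (hz : z ∈ Submodule.span F {a, 1}) :
    ⁅a, z⁆ = 0 := by
  obtain ⟨c, d, rfl⟩ := Submodule.mem_span_pair.1 hz
  rw [lie_smul_add_smul_one, lie_self, smul_zero]

theorem lie_mem_of_mem_span_pair_one {S : Submodule F B} {a z x : B}
    (hz : z ∈ Submodule.span F {a, 1}) (hx : ⁅a, x⁆ ∈ S) : ⁅z, x⁆ ∈ S := by
  obtain ⟨c, d, rfl⟩ := Submodule.mem_span_pair.1 hz
  rw [smul_add_smul_one_lie]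
  exact S.smul_mem c hx

variable (F) in
theorem exists_notMem_bot_of_mul_ne_mul (hB : ∃ u v : B, u * v ≠ v * u) :
    ∃ u : B, u ∉ (⊥ : Subalgebra F B) := by
  obtain ⟨u, v, huv⟩ := hB
  exact ⟨u, fun hu => huv (commute_iff_lie_eq.2 (lie_eq_zero_of_mem_bot hu v))⟩

end Algebra

section CentralAlgebra

variable {F B : Type*} [Field F] [Ring B] [Algebra F B]

theorem smul_mem_bot_iff {c : F} (hc : c ≠ 0) {a : B} :
    c • a ∈ (⊥ : Subalgebra F B) ↔ a ∈ (⊥ : Subalgebra F B) :=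
  (Subalgebra.toSubmodule (⊥ : Subalgebra F B)).smul_mem_iff hc

theorem exists_lie_notMem_bot [Algebra.IsCentral F B] {a : B} (ha : a ∉ (⊥ : Subalgebra F B)) :
    ∃ x : B, ⁅a, x⁆ ∉ (⊥ : Subalgebra F B) := by
  by_contra! hscalar
  refine ha (mem_bot_iff_forall_lie_eq_zero.2 fun x => ?_)
  obtain ⟨c, hc⟩ := Algebra.mem_bot.1 (hscalar x)
  have hca : c • a ∈ (⊥ : Subalgebra F B) := by
    rw [Algebra.smul_def, Algebra.commutes, hc, ← lie_self_mul]
    exact hscalar (a * x)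
  have hc0 : c = 0 := by
    by_contra hc0
    exact ha ((smul_mem_bot_iff hc0).1 hca)
  rw [← hc, hc0, map_zero]

theorem linearIndependent_pair_one [Nontrivial B] {a : B} (ha : a ∉ (⊥ : Subalgebra F B)) :
    LinearIndependent F ![a, 1] := by
  rw [LinearIndependent.pair_symm_iff, LinearIndependent.pair_iff' one_ne_zero]
  exact fun c hc => ha (Algebra.mem_bot.2 ⟨c, by rw [Algebra.algebraMap_eq_smul_one, hc]⟩)

theorem finrank_span_pair_one [Nontrivial B] {a : B} (ha : a ∉ (⊥ : Subalgebra F B)) :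
    Module.finrank F (Submodule.span F {a, 1}) = 2 := by
  rw [← Matrix.range_cons_cons_empty, finrank_span_eq_card (linearIndependent_pair_one ha),
    Fintype.card_fin]

theorem exists_lie_eq_self [Algebra.IsCentral F B] (hB : ∃ u v : B, u * v ≠ v * u)
    (h : ∀ a ∈ commutator (⊤ : AddSubgroup B) ⊤, a ∉ (⊥ : Subalgebra F B) →
      ∀ x : B, ⁅a, x⁆ ∈ Submodule.span F {a, 1}) :
    ∃ b ∈ commutator (⊤ : AddSubgroup B) ⊤, b ∉ (⊥ : Subalgebra F B) ∧ ∃ x : B, ⁅b, x⁆ = b := by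
  obtain ⟨u, hu⟩ := exists_notMem_bot_of_mul_ne_mul F hB
  obtain ⟨y, hw⟩ := exists_lie_notMem_bot hu
  obtain ⟨x, hb⟩ := exists_lie_notMem_bot hw
  obtain ⟨c, d, hcd⟩ := Submodule.mem_span_pair.1 (h _ (lie_mem_commutator_top u y) hw x)
  have hc : c ≠ 0 := by
    rintro rfl
    rw [← hcd, zero_smul, zero_add] at hb
    exact hb (Subalgebra.smul_mem _ (one_mem _) d)
  refine ⟨_, lie_mem_commutator_top ⁅u, y⁆ x, hb, c⁻¹ • x, ?_⟩
  calc ⁅⁅⁅u, y⁆, x⁆, c⁻¹ • x⁆ = c⁻¹ • ⁅c • ⁅u, y⁆ + d • 1, x⁆ := by rw [lie_smul c⁻¹, hcd]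
    _ = ⁅⁅u, y⁆, x⁆ := by rw [smul_add_smul_one_lie, inv_smul_smul₀ hc]

theorem exists_lie_notMem_span_singleton [IsPrimeRing B] {b x : B}
    (hb : b ∉ (⊥ : Subalgebra F B)) (hsq : b * b ∈ (⊥ : Subalgebra F B)) (hx : ⁅b, x⁆ = b) :
    ∃ y : B, ⁅b, y⁆ ∉ Submodule.span F {b} := by
  by_contra! hspan
  have hsq0 : b * b = 0 := by
    obtain ⟨c, hc⟩ := Submodule.mem_span_singleton.1 (hspan (b * x))
    rw [lie_self_mul, hx] at hc
    by_contra hne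
    have hc0 : c ≠ 0 := fun hc0 => hne (by rw [← hc, hc0, zero_smul])
    exact hb ((smul_mem_bot_iff hc0).1 (hc ▸ hsq))
  have hsandwich (r : B) : b * r * b = 0 := by
    obtain ⟨c, hc⟩ := Submodule.mem_span_singleton.1 (hspan r)
    have : b * ⁅b, r⁆ = 0 := by rw [← hc, mul_smul_comm, hsq0, smul_zero]
    simpa [Ring.lie_def, mul_sub, ← mul_assoc, hsq0] using this
  have hb0 : b = 0 := or_self_iff.1 (IsPrimeRing.eq_zero_or_eq_zero _ _ hsandwich)
  exact hb (hb0 ▸ zero_mem _)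

theorem exists_lie_eq_one [IsPrimeRing B] {b x : B} (hb : b ∉ (⊥ : Subalgebra F B))
    (hsq : b * b ∈ (⊥ : Subalgebra F B)) (hspan : ∀ z : B, ⁅b, z⁆ ∈ Submodule.span F {b, 1})
    (hx : ⁅b, x⁆ = b) : ∃ y : B, ⁅b, y⁆ = 1 := by
  obtain ⟨y, hy⟩ := exists_lie_notMem_span_singleton hb hsq hx
  obtain ⟨c, d, hcd⟩ := Submodule.mem_span_pair.1 (hspan y)
  have hd : d ≠ 0 := by
    rintro rfl
    exact hy (Submodule.mem_span_singleton.2 ⟨c, by rw [← hcd, zero_smul, add_zero]⟩)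
  refine ⟨d⁻¹ • (y - c • x), ?_⟩
  rw [lie_smul d⁻¹, lie_sub, lie_smul c, hx, ← hcd, add_sub_cancel_left, inv_smul_smul₀ hd]

theorem finrank_eq_four_of_lie_eq_self_of_lie_eq_one [Nontrivial B] {b x y : B}
    (hb : b ∉ (⊥ : Subalgebra F B)) (hspan : ∀ z : B, ⁅b, z⁆ ∈ Submodule.span F {b, 1})
    (hx : ⁅b, x⁆ = b) (hy : ⁅b, y⁆ = 1) : Module.finrank F B = 4 := by
  have hrange : LinearMap.range (LieAlgebra.ad F B b) = Submodule.span F {b, 1} := by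
    refine le_antisymm ?_ (Submodule.span_le.2 (Set.pair_subset ⟨x, hx⟩ ⟨y, hy⟩))
    rintro _ ⟨z, rfl⟩
    exact hspan z
  have hker : LinearMap.ker (LieAlgebra.ad F B b) = Submodule.span F {b, 1} := by
    refine le_antisymm (fun z hz => ?_) fun z hz => lie_eq_zero_of_mem_span_pair_one hz
    have hz' : ⁅b, z⁆ = 0 := hz
    simpa only [lie_mul, hz', hy, zero_mul, zero_add, mul_one] using hspan (z * y)
  have hrank : Module.rank F (Submodule.span F {b, 1}) = 2 := by
    have : FiniteDimensional F (Submodule.span F {b, 1}) :=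
      FiniteDimensional.span_of_finite F (Set.toFinite _)
    rw [← Module.finrank_eq_rank, finrank_span_pair_one hb, Nat.cast_ofNat]
  refine Module.finrank_eq_of_rank_eq ?_
  rw [← LinearMap.rank_range_add_rank_ker (LieAlgebra.ad F B b), hrange, hker, hrank]
  norm_num

theorem charP_two_and_finrank_eq_four_of_lie_mem_span [IsPrimeRing B] [Algebra.IsCentral F B]
    (hB : ∃ u v : B, u * v ≠ v * u)
    (h : ∀ a ∈ commutator (⊤ : AddSubgroup B) ⊤, a ∉ (⊥ : Subalgebra F B) →
      ∀ x : B, ⁅a, x⁆ ∈ Submodule.span F {a, 1}) :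
    CharP B 2 ∧ Module.finrank F B = 4 := by
  obtain ⟨b, hbcomm, hb, x, hx⟩ := exists_lie_eq_self hB h
  have hspan := h b hbcomm hb
  have hlie (z : B) : ⁅b, ⁅b, z⁆⁆ = 0 := lie_eq_zero_of_mem_span_pair_one (hspan z)
  have htwo : (2 : B) = 0 := by
    by_contra h2
    exact hb (mem_bot_iff_forall_lie_eq_zero.2 (lie_eq_zero_of_forall_lie_lie_eq_zero h2 hlie))
  have hchar : CharP B 2 := CharTwo.of_one_ne_zero_of_two_eq_zero one_ne_zero htwo
  have hsq : b * b ∈ (⊥ : Subalgebra F B) := mem_bot_iff_forall_lie_eq_zero.2 fun z => by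
    rw [← lie_lie_self_eq_lie_mul_self, hlie]
  obtain ⟨y, hy⟩ := exists_lie_eq_one hb hsq hspan hx
  exact ⟨hchar, finrank_eq_four_of_lie_eq_self_of_lie_eq_one hb hspan hx hy⟩

theorem mem_bot_of_forall_mul_lie_eq_smul_lie [IsPrimeRing B] [Algebra.IsCentral F B] {a : B}
    {c : F} (h : ∀ x : B, a * ⁅a, x⁆ = c • ⁅a, x⁆) : a ∈ (⊥ : Subalgebra F B) := by
  have hsub (x : B) : (a - algebraMap F B c) * ⁅a, x⁆ = 0 := by
    rw [sub_mul, h, ← Algebra.smul_def, sub_self]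
  have hsandwich (y x : B) : (a - algebraMap F B c) * x * ⁅a, y⁆ = 0 := by
    simpa only [lie_mul, mul_add, ← mul_assoc, hsub, zero_mul, zero_add] using hsub (x * y)
  by_cases hac : a - algebraMap F B c = 0
  · exact Algebra.mem_bot.2 ⟨c, (sub_eq_zero.1 hac).symm⟩
  · exact mem_bot_iff_forall_lie_eq_zero.2 fun y =>
      (IsPrimeRing.eq_zero_or_eq_zero _ _ (hsandwich y)).resolve_left hac

theorem two_le_finrank_range_ad [IsPrimeRing B] [Algebra.IsCentral F B] [FiniteDimensional F B]
    {a : B} (ha : a ∉ (⊥ : Subalgebra F B)) :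
    2 ≤ Module.finrank F (LinearMap.range (LieAlgebra.ad F B a)) := by
  by_contra! hlt
  obtain ⟨⟨_, y, rfl⟩, hv⟩ := finrank_le_one_iff.1 (Nat.le_of_lt_succ hlt)
  have hline (x : B) : ∃ c : F, c • ⁅a, y⁆ = ⁅a, x⁆ :=
    (hv ⟨_, x, rfl⟩).imp fun c hc => congrArg Subtype.val hc
  obtain ⟨c, hc⟩ := hline (a * y)
  refine ha (mem_bot_of_forall_mul_lie_eq_smul_lie (c := c) fun x => ?_)
  obtain ⟨d, hd⟩ := hline x
  rw [← hd, mul_smul_comm, ← lie_self_mul, ← hc, smul_comm]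

variable (F B) in
/-- Elements outside `F` have the smallest possible centralizer: only the elements of `F a + F`
commute with `a`. -/
def HasMinimalCentralizers : Prop :=
  ∀ a : B, a ∉ (⊥ : Subalgebra F B) → ∀ z : B, ⁅a, z⁆ = 0 → z ∈ Submodule.span F {a, 1}

theorem hasMinimalCentralizers_of_finrank_le_four [IsPrimeRing B] [Algebra.IsCentral F B]
    [FiniteDimensional F B] (hdim : Module.finrank F B ≤ 4) : HasMinimalCentralizers F B := by
  intro a ha z hz
  have hle : Submodule.span F {a, 1} ≤ LinearMap.ker (LieAlgebra.ad F B a) :=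
    fun z hz => lie_eq_zero_of_mem_span_pair_one hz
  have hker : Module.finrank F (LinearMap.ker (LieAlgebra.ad F B a)) ≤
      Module.finrank F (Submodule.span F {a, 1}) := by
    have hrange := two_le_finrank_range_ad ha
    have hsum := LinearMap.finrank_range_add_finrank_ker (LieAlgebra.ad F B a)
    rw [finrank_span_pair_one ha]
    lia
  rw [Submodule.eq_of_le_of_finrank_le hle hker]
  exact hz

namespace HasMinimalCentralizers

variable (hC : HasMinimalCentralizers F B)

include hC

theorem mem_bot_of_lie_eq_zero {a b z : B} (hab : ⁅a, b⁆ ≠ 0) (ha : ⁅a, z⁆ = 0)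
    (hb : ⁅b, z⁆ = 0) : z ∈ (⊥ : Subalgebra F B) := by
  by_contra hz
  have hzb : ⁅z, b⁆ = 0 := by rw [← lie_skew, hb, neg_zero]
  obtain ⟨c, d, rfl⟩ := Submodule.mem_span_pair.1 (hC z hz b hzb)
  exact hab (by rw [lie_smul_add_smul_one, ha, smul_zero])

variable [CharP B 2]

theorem exists_lie_lie_eq_smul (a b : B) : ∃ c : F, ⁅a, ⁅a, b⁆⁆ = c • ⁅a, b⁆ := by
  by_cases ha : a ∈ (⊥ : Subalgebra F B)
  · exact ⟨0, by rw [lie_eq_zero_of_mem_bot ha, zero_smul]⟩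
  · have hsq : ⁅a, a * a⁆ = 0 := by rw [lie_self_mul, lie_self, mul_zero]
    obtain ⟨c, d, hcd⟩ := Submodule.mem_span_pair.1 (hC a ha (a * a) hsq)
    exact ⟨c, by rw [lie_lie_self_eq_lie_mul_self, ← hcd, smul_add_smul_one_lie]⟩

theorem lie_mul_lie_mem_bot (a b : B) : ⁅a, b⁆ * ⁅a, b⁆ ∈ (⊥ : Subalgebra F B) := by
  by_cases hab : ⁅a, b⁆ = 0
  · rw [hab, mul_zero]
    exact zero_mem _
  have hsq {x w : B} {c : F} (hw : ⁅x, w⁆ = c • w) : ⁅x, w * w⁆ = 0 := by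
    rw [lie_mul, hw, smul_mul_assoc, mul_smul_comm, CharTwo.add_self_eq_zero]
  obtain ⟨c, hc⟩ := hC.exists_lie_lie_eq_smul a b
  obtain ⟨d, hd⟩ := hC.exists_lie_lie_eq_smul b a
  rw [← lie_skew b a, lie_neg, smul_neg, neg_inj] at hd
  exact hC.mem_bot_of_lie_eq_zero hab (hsq hc) (hsq hd)

theorem add_mul_add_mem_bot {a b : B} (ha : a * a ∈ (⊥ : Subalgebra F B))
    (hb : b * b ∈ (⊥ : Subalgebra F B)) : (a + b) * (a + b) ∈ (⊥ : Subalgebra F B) := by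
  have hlie : ⁅a, b⁆ ∈ (⊥ : Subalgebra F B) := by
    by_cases hab : ⁅a, b⁆ = 0
    · rw [hab]
      exact zero_mem _
    · refine hC.mem_bot_of_lie_eq_zero hab ?_ ?_
      · rw [lie_lie_self_eq_lie_mul_self, lie_eq_zero_of_mem_bot ha]
      · rw [← lie_skew a b, lie_neg, lie_lie_self_eq_lie_mul_self, lie_eq_zero_of_mem_bot hb,
          neg_zero]
  have hexpand : (a + b) * (a + b) = a * a + b * b + ⁅a, b⁆ := by
    rw [Ring.lie_def, CharTwo.sub_eq_add]
    noncomm_ring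
  rw [hexpand]
  exact add_mem (add_mem ha hb) hlie

theorem mul_self_mem_bot_of_mem_commutator {a : B} (ha : a ∈ commutator (⊤ : AddSubgroup B) ⊤) :
    a * a ∈ (⊥ : Subalgebra F B) := by
  induction ha using AddSubgroup.closure_induction with
  | mem x hx =>
    obtain ⟨a, -, b, -, rfl⟩ := hx
    exact hC.lie_mul_lie_mem_bot a b
  | zero => rw [mul_zero]; exact zero_mem _
  | add x y _ _ hx hy => exact hC.add_mul_add_mem_bot hx hy
  | neg x _ hx => rwa [neg_mul_neg]

theorem lie_mem_span_of_mem_commutator {a : B} (ha : a ∈ commutator (⊤ : AddSubgroup B) ⊤)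
    (ha' : a ∉ (⊥ : Subalgebra F B)) (x : B) : ⁅a, x⁆ ∈ Submodule.span F {a, 1} := by
  refine hC a ha' _ ?_
  rw [lie_lie_self_eq_lie_mul_self,
    lie_eq_zero_of_mem_bot (hC.mul_self_mem_bot_of_mem_commutator ha)]

end HasMinimalCentralizers

theorem charP_two_and_finrank_eq_four_iff [IsPrimeRing B] [Algebra.IsCentral F B]
    (hB : ∃ u v : B, u * v ≠ v * u) :
    CharP B 2 ∧ Module.finrank F B = 4 ↔
      ∀ a ∈ commutator (⊤ : AddSubgroup B) ⊤, a ∉ (⊥ : Subalgebra F B) →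
        ∀ x : B, ⁅a, x⁆ ∈ Submodule.span F {a, 1} := by
  refine ⟨fun ⟨_, hdim⟩ a ha ha' => ?_, charP_two_and_finrank_eq_four_of_lie_mem_span hB⟩
  have : FiniteDimensional F B := .of_finrank_pos (by lia)
  exact (hasMinimalCentralizers_of_finrank_le_four hdim.le).lie_mem_span_of_mem_commutator ha ha'

end CentralAlgebra

end LieBracket

section MartindaleQuotient

variable {R : Type*} [NonUnitalRing R] [IsPrimeRing R]

namespace SymmQuot

theorem ofRing_injective : Function.Injective (ofRing R) := by
  refine (injective_iff_map_eq_zero _).2 fun a ha => ?_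
  obtain ⟨K, hK, -, -, h⟩ := Quotient.exact ha
  exact IsPrimeRing.eq_zero_of_forall_mul_eq_zero hK fun x hx => (h x hx).1.trans (zero_mul x)

/-- The element of `Q_s(R)` represented by a balanced pair. -/
def mk (p : BalancedPair R) : SymmQuot R := Quotient.mk _ p

theorem mk_eq_mk {p q : BalancedPair R} (h : p ≈ q) : mk p = mk q := Quotient.sound h

theorem ofRing_mul_mk (p : BalancedPair R) {x : R} (hx : x ∈ p.dom) :
    ofRing R x * mk p = ofRing R (p.r x) := by
  refine mk_eq_mk (p := .mul (.ofElem x) p) (q := .ofElem _)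
    (BalancedPair.equiv_of_eq_on _ _ fun y hy => ?_)
  have hy := ((TwoSidedIdeal.mem_inf R).1
    (TwoSidedIdeal.square_le _ ((TwoSidedIdeal.mem_inf R).1 hy).1)).2
  exact ⟨p.balanced x hx y hy, p.r_mul x hx y⟩

theorem mk_mul_ofRing (p : BalancedPair R) {x : R} (hx : x ∈ p.dom) :
    mk p * ofRing R x = ofRing R (p.l x) := by
  refine mk_eq_mk (p := .mul p (.ofElem x)) (q := .ofElem _)
    (BalancedPair.equiv_of_eq_on _ _ fun y hy => ?_)
  have hy := ((TwoSidedIdeal.mem_inf R).1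
    (TwoSidedIdeal.square_le _ ((TwoSidedIdeal.mem_inf R).1 hy).1)).1
  exact ⟨p.l_mul x hx y, (p.balanced y hy x hx).symm⟩

theorem exists_ideal_mul_mem_range (q : SymmQuot R) : ∃ I : TwoSidedIdeal R, I ≠ ⊥ ∧
    ∀ x ∈ I, (∃ y, q * ofRing R x = ofRing R y) ∧ ∃ y, ofRing R x * q = ofRing R y := by
  obtain ⟨p, rfl⟩ := Quotient.exists_rep q
  exact ⟨p.dom, p.dom_ne_bot, fun x hx => ⟨⟨_, mk_mul_ofRing p hx⟩, ⟨_, ofRing_mul_mk p hx⟩⟩⟩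

theorem eq_zero_of_forall_mul_ofRing_eq_zero {I : TwoSidedIdeal R} (hI : I ≠ ⊥) {q : SymmQuot R}
    (h : ∀ x ∈ I, q * ofRing R x = 0) : q = 0 := by
  obtain ⟨p, rfl⟩ := Quotient.exists_rep q
  have hK := TwoSidedIdeal.inf_ne_bot hI p.dom_ne_bot
  have hmemI : ∀ x ∈ I ⊓ p.dom, x ∈ I := fun x hx => ((TwoSidedIdeal.mem_inf R).1 hx).1
  have hdom : ∀ x ∈ I ⊓ p.dom, x ∈ p.dom := fun x hx => ((TwoSidedIdeal.mem_inf R).1 hx).2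
  have hl : ∀ x ∈ I ⊓ p.dom, p.l x = 0 := fun x hx => ofRing_injective <| by
    rw [map_zero, ← mk_mul_ofRing p (hdom x hx)]
    exact h x (hmemI x hx)
  have hr : ∀ x ∈ I ⊓ p.dom, p.r x = 0 := fun x hx =>
    IsPrimeRing.eq_zero_of_forall_mul_eq_zero hK fun y hy => by
      rw [← p.balanced x (hdom x hx) y (hdom y hy), hl y hy, mul_zero]
  exact mk_eq_mk (q := .ofElem 0) ⟨I ⊓ p.dom, hK, hdom, fun x _ => TwoSidedIdeal.mem_top R,
    fun x hx => ⟨(hl x hx).trans (zero_mul x).symm, (hr x hx).trans (mul_zero x).symm⟩⟩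

theorem eq_zero_of_forall_ofRing_mul_eq_zero {I : TwoSidedIdeal R} (hI : I ≠ ⊥) {q : SymmQuot R}
    (h : ∀ x ∈ I, ofRing R x * q = 0) : q = 0 := by
  obtain ⟨J, hJ, hJq⟩ := exists_ideal_mul_mem_range q
  refine eq_zero_of_forall_mul_ofRing_eq_zero hJ fun y hy => ?_
  obtain ⟨z, hz⟩ := (hJq y hy).1
  have hz0 : z = 0 := IsPrimeRing.eq_zero_of_forall_mul_eq_zero' hI fun x hx =>
    ofRing_injective <| by rw [map_mul, ← hz, ← mul_assoc, h x hx, zero_mul, map_zero]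
  rw [hz, hz0, map_zero]

theorem eq_zero_or_eq_zero_of_forall_mul_ofRing_mul {q q' : SymmQuot R}
    (h : ∀ r, q * ofRing R r * q' = 0) : q = 0 ∨ q' = 0 := by
  by_contra! hne
  obtain ⟨I, hI, hIq⟩ := exists_ideal_mul_mem_range q
  obtain ⟨J, hJ, hJq⟩ := exists_ideal_mul_mem_range q'
  obtain ⟨x, hx, hx0⟩ : ∃ x ∈ I, ofRing R x * q ≠ 0 := by
    by_contra! h
    exact hne.1 (eq_zero_of_forall_ofRing_mul_eq_zero hI h)
  obtain ⟨y, hy, hy0⟩ : ∃ y ∈ J, q' * ofRing R y ≠ 0 := by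
    by_contra! h
    exact hne.2 (eq_zero_of_forall_mul_ofRing_eq_zero hJ h)
  obtain ⟨a, ha⟩ := (hIq x hx).2
  obtain ⟨b, hb⟩ := (hJq y hy).1
  have hab (r : R) : a * r * b = 0 := ofRing_injective <| by
    calc ofRing R (a * r * b) = ofRing R x * (q * ofRing R r * q') * ofRing R y := by
          simp only [map_mul, ← ha, ← hb, mul_assoc]
      _ = ofRing R 0 := by rw [h, mul_zero, zero_mul, map_zero]
  rcases IsPrimeRing.eq_zero_or_eq_zero a b hab with rfl | rfl
  · exact hx0 (ha.trans (map_zero _))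
  · exact hy0 (hb.trans (map_zero _))

instance : Nontrivial (SymmQuot R) := ofRing_injective.nontrivial

theorem mem_extCentroid_of_forall_commute_ofRing {q : SymmQuot R}
    (h : ∀ r, q * ofRing R r = ofRing R r * q) : q ∈ ExtCentroid R := by
  refine Subring.mem_center_iff.2 fun z => sub_eq_zero.1 ?_
  obtain ⟨I, hI, hIz⟩ := exists_ideal_mul_mem_range z
  refine eq_zero_of_forall_mul_ofRing_eq_zero hI fun x hx => ?_
  obtain ⟨y, hy⟩ := (hIz x hx).1
  rw [sub_mul, mul_assoc, mul_assoc, h, hy, h, ← mul_assoc, hy, sub_self]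

end SymmQuot

namespace ExtCentroid

open SymmQuot

theorem mul_comm (c : ExtCentroid R) (q : SymmQuot R) : c * q = q * c :=
  (Subring.mem_center_iff.1 c.2 q).symm

theorem mul_left_cancel {c : ExtCentroid R} (hc : c ≠ 0) {q q' : SymmQuot R}
    (h : (c : SymmQuot R) * q = c * q') : q = q' := by
  refine sub_eq_zero.1 ((eq_zero_or_eq_zero_of_forall_mul_ofRing_mul (q := c)
    fun r => ?_).resolve_left fun h0 => hc (Subtype.ext h0))
  rw [mul_comm c, mul_assoc, mul_sub, h, sub_self, mul_zero]

/-- The ideal `R ∩ c R` of `R`, for `c` in the extended centroid: the domain on which division by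
`c` is defined. -/
def divIdeal (c : ExtCentroid R) : TwoSidedIdeal R :=
  TwoSidedIdeal.mk' {w | ∃ x, ofRing R w = c * ofRing R x}
    ⟨0, by rw [map_zero, mul_zero]⟩
    (fun ⟨x, hx⟩ ⟨y, hy⟩ => ⟨x + y, by rw [map_add, map_add, hx, hy, mul_add]⟩)
    (fun ⟨x, hx⟩ => ⟨-x, by rw [map_neg, map_neg, hx, mul_neg]⟩)
    (fun {s _} ⟨x, hx⟩ => ⟨s * x, by
      rw [map_mul, map_mul, hx, ← mul_assoc, ← mul_comm, mul_assoc]⟩)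
    (fun {_ s} ⟨x, hx⟩ => ⟨x * s, by rw [map_mul, map_mul, hx, mul_assoc]⟩)

theorem mem_divIdeal {c : ExtCentroid R} {w : R} :
    w ∈ divIdeal c ↔ ∃ x, ofRing R w = c * ofRing R x :=
  TwoSidedIdeal.mem_mk' _ _ _ _ _ _ _

theorem divIdeal_ne_bot {c : ExtCentroid R} (hc : c ≠ 0) : divIdeal c ≠ ⊥ := by
  obtain ⟨I, hI, hIc⟩ := exists_ideal_mul_mem_range (c : SymmQuot R)
  obtain ⟨x, hx, hx0⟩ := TwoSidedIdeal.exists_ne_zero_of_ne_bot hI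
  obtain ⟨y, hy⟩ := (hIc x hx).1
  refine TwoSidedIdeal.ne_bot_of_mem (mem_divIdeal.2 ⟨x, hy.symm⟩) ?_
  rintro rfl
  refine hx0 (ofRing_injective (mul_left_cancel hc ?_))
  rw [hy, map_zero, mul_zero]

theorem exists_mul_eq_one {c : ExtCentroid R} (hc : c ≠ 0) : ∃ q : SymmQuot R, c * q = 1 := by
  choose! g hg using fun (w : R) (hw : w ∈ divIdeal c) => mem_divIdeal.1 hw
  have hunique : ∀ w ∈ divIdeal c, ∀ x, ofRing R w = c * ofRing R x → g w = x :=
    fun w hw x hx => ofRing_injective (mul_left_cancel hc ((hg w hw).symm.trans hx))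
  have hadd : ∀ x ∈ divIdeal c, ∀ y ∈ divIdeal c, g (x + y) = g x + g y := fun x hx y hy =>
    hunique _ (add_mem hx hy) _ (by rw [map_add, map_add, hg x hx, hg y hy, mul_add])
  have hmul_right : ∀ x ∈ divIdeal c, ∀ s, g (x * s) = g x * s := fun x hx s =>
    hunique _ (TwoSidedIdeal.mul_mem_right _ _ _ hx) _
      (by rw [map_mul, map_mul, hg x hx, mul_assoc])
  have hmul_left : ∀ x ∈ divIdeal c, ∀ s, g (s * x) = s * g x := fun x hx s =>
    hunique _ (TwoSidedIdeal.mul_mem_left _ _ _ hx) _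
      (by rw [map_mul, map_mul, hg x hx, ← mul_assoc, ← mul_comm, mul_assoc])
  let p : BalancedPair R :=
    { dom := divIdeal c, dom_ne_bot := divIdeal_ne_bot hc, l := g, r := g, l_add := hadd,
      l_mul := hmul_right, r_add := hadd, r_mul := hmul_left,
      balanced := fun x hx y hy => by rw [← hmul_left y hy, hmul_right x hx] }
  refine ⟨mk p, sub_eq_zero.1 (eq_zero_of_forall_mul_ofRing_eq_zero (divIdeal_ne_bot hc)
    fun w hw => ?_)⟩
  rw [sub_mul, mul_assoc, mk_mul_ofRing p hw, ← hg w hw, one_mul, sub_self]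

theorem isField : IsField (ExtCentroid R) where
  exists_pair_ne := exists_pair_ne _
  mul_comm := _root_.mul_comm
  mul_inv_cancel {c} hc := by
    obtain ⟨q, hq⟩ := exists_mul_eq_one hc
    refine ⟨⟨q, Subring.mem_center_iff.2 fun z => mul_left_cancel hc ?_⟩, Subtype.ext hq⟩
    rw [← mul_assoc, mul_comm c z, mul_assoc, hq, mul_one, ← mul_assoc, hq, one_mul]

end ExtCentroid

end MartindaleQuotient

section CentralClosure

variable {R : Type*} [NonUnitalRing R] [IsPrimeRing R]

open SymmQuot

theorem ofRing_mem_centralClosure (r : R) : ofRing R r ∈ centralClosure R :=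
  Submodule.subset_span ⟨r, rfl⟩

theorem centralClosure_mul_mem {x y : SymmQuot R} (hx : x ∈ centralClosure R)
    (hy : y ∈ centralClosure R) : x * y ∈ centralClosure R := by
  have hxy := Submodule.mul_mem_mul hx hy
  rw [centralClosure, Submodule.span_mul_span] at hxy
  refine Submodule.span_mono ?_ hxy
  rintro _ ⟨_, ⟨a, rfl⟩, _, ⟨b, rfl⟩, rfl⟩
  exact ⟨a * b, map_mul _ a b⟩

theorem commutator_centralClosure_le :
    commutator (centralClosure R).toAddSubgroup (centralClosure R).toAddSubgroup ≤
      (centralClosure R).toAddSubgroup := by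
  refine (AddSubgroup.closure_le _).2 ?_
  rintro _ ⟨x, hx, y, hy, rfl⟩
  exact sub_mem (centralClosure_mul_mem hx hy) (centralClosure_mul_mem hy hx)

variable (R) in
/-- The subalgebra `RC + C` of `Q_s(R)` generated by `RC`. It stands in for `RC`, which is not known
to contain `1`, wherever a unital algebra is needed. -/
def unitalClosure : Subalgebra (ExtCentroid R) (SymmQuot R) :=
  Algebra.adjoin (ExtCentroid R) (centralClosure R)

theorem toSubmodule_unitalClosure : Subalgebra.toSubmodule (unitalClosure R) =
    Submodule.span (ExtCentroid R) {1} ⊔ centralClosure R := by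
  have hclosure : Subsemigroup.closure (centralClosure R : Set (SymmQuot R)) =
      ⟨centralClosure R, centralClosure_mul_mem⟩ :=
    Subsemigroup.closure_eq ⟨_, centralClosure_mul_mem⟩
  rw [unitalClosure, Algebra.adjoin_eq_span, Submonoid.closure_eq_one_union, Submodule.span_union,
    hclosure, Subsemigroup.coe_set_mk, Submodule.span_eq]

theorem centralClosure_le_unitalClosure {x : SymmQuot R} (hx : x ∈ centralClosure R) :
    x ∈ unitalClosure R :=
  Algebra.subset_adjoin hx

theorem toSubmodule_unitalClosure_eq_centralClosure (h1 : (1 : SymmQuot R) ∈ centralClosure R) :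
    Subalgebra.toSubmodule (unitalClosure R) = centralClosure R := by
  rw [toSubmodule_unitalClosure, sup_eq_right, Submodule.span_singleton_le_iff_mem]
  exact h1

theorem exists_smul_one_add_eq_of_mem_unitalClosure {x : SymmQuot R} (hx : x ∈ unitalClosure R) :
    ∃ c : ExtCentroid R, ∃ u ∈ centralClosure R, c • 1 + u = x := by
  rw [← Subalgebra.mem_toSubmodule, toSubmodule_unitalClosure] at hx
  obtain ⟨_, hc, u, hu, rfl⟩ := Submodule.mem_sup.1 hx
  obtain ⟨c, rfl⟩ := Submodule.mem_span_singleton.1 hc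
  exact ⟨c, u, hu, rfl⟩

/-- The inclusion of `R` into the unital closure. -/
def ofRingUnital (r : R) : unitalClosure R :=
  ⟨ofRing R r, centralClosure_le_unitalClosure (ofRing_mem_centralClosure r)⟩

instance : IsPrimeRing (unitalClosure R) where
  eq_zero_or_eq_zero _ _ h :=
    (eq_zero_or_eq_zero_of_forall_mul_ofRing_mul fun r =>
      congrArg Subtype.val (h (ofRingUnital r))).imp Subtype.ext Subtype.ext

theorem mem_bot_unitalClosure_iff {a : unitalClosure R} :
    a ∈ (⊥ : Subalgebra (ExtCentroid R) (unitalClosure R)) ↔ (a : SymmQuot R) ∈ ExtCentroid R := by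
  refine Algebra.mem_bot.trans ⟨?_, fun ha => ⟨⟨a, ha⟩, rfl⟩⟩
  rintro ⟨c, rfl⟩
  exact c.2

instance : Algebra.IsCentral (ExtCentroid R) (unitalClosure R) where
  out _ ha := mem_bot_unitalClosure_iff.2 <| mem_extCentroid_of_forall_commute_ofRing fun r =>
    congrArg Subtype.val (Subalgebra.mem_center_iff.1 ha (ofRingUnital r)).symm

theorem exists_mul_ne_mul_unitalClosure (hR : ∃ x y : R, x * y ≠ y * x) :
    ∃ u v : unitalClosure R, u * v ≠ v * u := by
  obtain ⟨x, y, hxy⟩ := hR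
  refine ⟨ofRingUnital x, ofRingUnital y, fun h => hxy (ofRing_injective ?_)⟩
  rw [map_mul, map_mul]
  exact congrArg Subtype.val h

theorem map_commutator_unitalClosure :
    (commutator (⊤ : AddSubgroup (unitalClosure R)) ⊤).map (unitalClosure R).val.toAddMonoidHom =
      commutator (centralClosure R).toAddSubgroup (centralClosure R).toAddSubgroup := by
  rw [commutator, commutator, AddMonoidHom.map_closure]
  congr 1
  ext z
  constructor
  · rintro ⟨_, ⟨⟨u, hu⟩, -, ⟨v, hv⟩, -, rfl⟩, rfl⟩
    obtain ⟨c, x, hx, rfl⟩ := exists_smul_one_add_eq_of_mem_unitalClosure hu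
    obtain ⟨d, y, hy, rfl⟩ := exists_smul_one_add_eq_of_mem_unitalClosure hv
    refine ⟨x, hx, y, hy, ?_⟩
    change (c • 1 + x) * (d • 1 + y) - (d • 1 + y) * (c • 1 + x) = _
    simp only [add_mul, mul_add, smul_mul_assoc, mul_smul_comm, one_mul, mul_one]
    module
  · rintro ⟨x, hx, y, hy, rfl⟩
    exact ⟨_, ⟨⟨x, centralClosure_le_unitalClosure hx⟩, trivial,
      ⟨y, centralClosure_le_unitalClosure hy⟩, trivial, rfl⟩, rfl⟩

theorem mem_affineLine_iff {a x : unitalClosure R} :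
    (x : SymmQuot R) ∈ affineLine (a : SymmQuot R) ↔
      x ∈ Submodule.span (ExtCentroid R) {a, 1} := by
  rw [affineLine, Submodule.mem_toAddSubgroup, ← Submodule.span_insert, Submodule.mem_span_pair,
    Submodule.mem_span_pair]
  exact exists₂_congr fun _ _ => ⟨fun h => Subtype.ext h, fun h => congrArg Subtype.val h⟩

/-- `RC` as an ideal of `RC + C`. -/
def centralClosureIdeal (R : Type*) [NonUnitalRing R] [IsPrimeRing R] :
    Ideal (unitalClosure R) where
  carrier := {w | (w : SymmQuot R) ∈ centralClosure R}
  zero_mem' := (centralClosure R).zero_mem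
  add_mem' := (centralClosure R).add_mem
  smul_mem' s w hw := by
    obtain ⟨c, u, hu, h⟩ := exists_smul_one_add_eq_of_mem_unitalClosure s.2
    change (s : SymmQuot R) * w ∈ centralClosure R
    rw [← h, add_mul, smul_mul_assoc, one_mul]
    exact add_mem (Submodule.smul_mem _ c hw) (centralClosure_mul_mem hu hw)

theorem mem_centralClosureIdeal {w : unitalClosure R} :
    w ∈ centralClosureIdeal R ↔ (w : SymmQuot R) ∈ centralClosure R :=
  Iff.rfl

instance : (centralClosureIdeal R).IsTwoSided where
  mul_mem_of_left s hw := by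
    obtain ⟨c, u, hu, h⟩ := exists_smul_one_add_eq_of_mem_unitalClosure s.2
    rw [mem_centralClosureIdeal] at hw ⊢
    change _ * (s : SymmQuot R) ∈ centralClosure R
    rw [← h, mul_add, mul_smul_comm, mul_one]
    exact add_mem (Submodule.smul_mem _ c hw) (centralClosure_mul_mem hw hu)

theorem centralClosureIdeal_ne_bot : centralClosureIdeal R ≠ ⊥ := by
  obtain ⟨r, hr⟩ := exists_ne (0 : R)
  intro hbot
  have hmem : ofRingUnital r ∈ centralClosureIdeal R := ofRing_mem_centralClosure r
  rw [hbot, Ideal.mem_bot] at hmem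
  exact hr (ofRing_injective ((congrArg Subtype.val hmem).trans (map_zero _).symm))

theorem one_mem_centralClosure_of_finite [Module.Finite (ExtCentroid R) (centralClosure R)] :
    (1 : SymmQuot R) ∈ centralClosure R := by
  let _ : Field (ExtCentroid R) := ExtCentroid.isField.toField
  have : Module.Finite (ExtCentroid R) (unitalClosure R) := by
    change Module.Finite (ExtCentroid R) (Subalgebra.toSubmodule (unitalClosure R))
    rw [toSubmodule_unitalClosure]
    infer_instance
  have : IsArtinianRing (unitalClosure R) := IsArtinianRing.of_finite (ExtCentroid R) _
  have htop := IsPrimeRing.eq_top_of_isTwoSided (centralClosureIdeal_ne_bot (R := R))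
  exact mem_centralClosureIdeal.1 ((Ideal.eq_top_iff_one _).1 htop)

theorem charP_two_unitalClosure_iff : CharP (unitalClosure R) 2 ↔ AddMonoid.exponent R = 2 := by
  constructor
  · intro _
    have hdvd : AddMonoid.exponent R ∣ 2 :=
      AddMonoid.exponent_dvd_iff_forall_nsmul_eq_zero.2 fun r => ofRing_injective <| by
        rw [map_nsmul, map_zero, two_nsmul]
        exact congrArg Subtype.val (CharTwo.add_self_eq_zero (ofRingUnital r))
    refine (Nat.prime_two.eq_one_or_self_of_dvd _ hdvd).resolve_left fun h1 => ?_
    exact not_subsingleton R (AddMonoid.exp_eq_one_iff.1 h1)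
  · intro hexp
    refine CharTwo.of_one_ne_zero_of_two_eq_zero one_ne_zero (Subtype.ext ?_)
    obtain ⟨x, hx⟩ := exists_ne (0 : R)
    refine eq_zero_of_forall_mul_ofRing_eq_zero
      (TwoSidedIdeal.ne_bot_of_mem (TwoSidedIdeal.mem_top R) hx) fun r _ => ?_
    have h2r : (2 : ℕ) • r = 0 :=
      AddMonoid.exponent_dvd_iff_forall_nsmul_eq_zero.1 (dvd_of_eq hexp) r
    change (2 : SymmQuot R) * _ = 0
    rw [two_mul, ← map_add, ← two_nsmul, h2r, map_zero]

theorem isExceptional_iff : IsExceptional R ↔ (1 : SymmQuot R) ∈ centralClosure R ∧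
    CharP (unitalClosure R) 2 ∧ Module.finrank (ExtCentroid R) (unitalClosure R) = 4 := by
  let _ : Field (ExtCentroid R) := ExtCentroid.isField.toField
  have finrank_eq (h1 : (1 : SymmQuot R) ∈ centralClosure R) :
      Module.finrank (ExtCentroid R) (unitalClosure R) =
        Module.finrank (ExtCentroid R) (centralClosure R) := by
    rw [← toSubmodule_unitalClosure_eq_centralClosure h1]
    rfl
  rw [IsExceptional, charP_two_unitalClosure_iff]
  constructor
  · rintro ⟨hchar, hdim⟩
    have := Module.finite_of_finrank_pos (hdim.symm ▸ four_pos)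
    have h1 := one_mem_centralClosure_of_finite (R := R)
    exact ⟨h1, hchar, (finrank_eq h1).trans hdim⟩
  · rintro ⟨h1, hchar, hdim⟩
    exact ⟨hchar, (finrank_eq h1).symm.trans hdim⟩

theorem isLieIdealOf_affineLine_iff {a : unitalClosure R}
    (ha : (a : SymmQuot R) ∈ centralClosure R) :
    IsLieIdealOf (affineLine (a : SymmQuot R)) (centralClosure R).toAddSubgroup ↔
      (1 : SymmQuot R) ∈ centralClosure R ∧
        ∀ x, ⁅a, x⁆ ∈ Submodule.span (ExtCentroid R) {a, 1} := by
  constructor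
  · rintro ⟨hle, hlie⟩
    have h1 : (1 : SymmQuot R) ∈ centralClosure R :=
      hle (mem_affineLine_iff (x := 1).2 (Submodule.subset_span (by simp)))
    refine ⟨h1, fun x => mem_affineLine_iff.1 (hlie (AddSubgroup.subset_closure ?_))⟩
    refine ⟨a, mem_affineLine_iff.2 (Submodule.subset_span (by simp)), x, ?_, rfl⟩
    rw [← toSubmodule_unitalClosure_eq_centralClosure h1]
    exact x.2
  · rintro ⟨h1, hspan⟩
    have hle : affineLine (a : SymmQuot R) ≤ (centralClosure R).toAddSubgroup :=
      Submodule.toAddSubgroup_mono <| sup_le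
        ((Submodule.span_singleton_le_iff_mem _ _).2 ha)
        ((Submodule.span_singleton_le_iff_mem _ _).2 h1)
    refine ⟨hle, (AddSubgroup.closure_le _).2 ?_⟩
    rintro _ ⟨z, hz, x, hx, rfl⟩
    lift z to unitalClosure R using centralClosure_le_unitalClosure (hle hz)
    lift x to unitalClosure R using centralClosure_le_unitalClosure hx
    have hzx : ⁅z, x⁆ ∈ Submodule.span (ExtCentroid R) {a, 1} :=
      lie_mem_of_mem_span_pair_one (mem_affineLine_iff.1 hz) (hspan x)
    exact mem_affineLine_iff.2 hzx

theorem forall_isLieIdealOf_affineLine_iff (hR : ∃ x y : R, x * y ≠ y * x) :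
    (∀ a ∈ commutator (centralClosure R).toAddSubgroup (centralClosure R).toAddSubgroup,
        a ∉ ExtCentroid R → IsLieIdealOf (affineLine a) (centralClosure R).toAddSubgroup) ↔
      (1 : SymmQuot R) ∈ centralClosure R ∧
        ∀ a ∈ commutator (⊤ : AddSubgroup (unitalClosure R)) ⊤,
          a ∉ (⊥ : Subalgebra (ExtCentroid R) (unitalClosure R)) →
            ∀ x, ⁅a, x⁆ ∈ Submodule.span (ExtCentroid R) {a, 1} := by
  let _ : Field (ExtCentroid R) := ExtCentroid.isField.toField
  have hmap {a : unitalClosure R} (ha : a ∈ commutator (⊤ : AddSubgroup (unitalClosure R)) ⊤) :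
      (a : SymmQuot R) ∈
        commutator (centralClosure R).toAddSubgroup (centralClosure R).toAddSubgroup :=
    map_commutator_unitalClosure (R := R) ▸ AddSubgroup.mem_map_of_mem _ ha
  constructor
  · intro h
    have h' (a : unitalClosure R) (ha : a ∈ commutator (⊤ : AddSubgroup (unitalClosure R)) ⊤)
        (hbot : a ∉ (⊥ : Subalgebra (ExtCentroid R) (unitalClosure R))) :=
      (isLieIdealOf_affineLine_iff (commutator_centralClosure_le (hmap ha))).1
        (h a (hmap ha) (mt mem_bot_unitalClosure_iff.2 hbot))
    obtain ⟨u, hu⟩ :=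
      exists_notMem_bot_of_mul_ne_mul (ExtCentroid R) (exists_mul_ne_mul_unitalClosure hR)
    obtain ⟨v, huv⟩ := exists_lie_notMem_bot hu
    exact ⟨(h' _ (lie_mem_commutator_top u v) huv).1, fun a ha hbot => (h' a ha hbot).2⟩
  · rintro ⟨h1, h⟩ a ha hC
    rw [← map_commutator_unitalClosure] at ha
    obtain ⟨a, ha, rfl⟩ := ha
    exact (isLieIdealOf_affineLine_iff (commutator_centralClosure_le (hmap ha))).2
      ⟨h1, h a ha (mt mem_bot_unitalClosure_iff.1 hC)⟩

theorem charP_two_and_finrank_unitalClosure_eq_four_iff (hR : ∃ x y : R, x * y ≠ y * x) :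
    CharP (unitalClosure R) 2 ∧ Module.finrank (ExtCentroid R) (unitalClosure R) = 4 ↔
      ∀ a ∈ commutator (⊤ : AddSubgroup (unitalClosure R)) ⊤,
        a ∉ (⊥ : Subalgebra (ExtCentroid R) (unitalClosure R)) →
          ∀ x, ⁅a, x⁆ ∈ Submodule.span (ExtCentroid R) {a, 1} :=
  let _ : Field (ExtCentroid R) := ExtCentroid.isField.toField
  charP_two_and_finrank_eq_four_iff (exists_mul_ne_mul_unitalClosure hR)

end CentralClosure

end PrimeRing

theorem mainTheorem11 {R : Type*} [NonUnitalRing R] [IsPrimeRing R]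
    (hR : ∃ x y : R, x * y ≠ y * x) :
    PrimeRing.IsExceptional R ↔
      ∀ a ∈ PrimeRing.commutator (PrimeRing.centralClosure R).toAddSubgroup
          (PrimeRing.centralClosure R).toAddSubgroup,
        a ∉ PrimeRing.ExtCentroid R →
          PrimeRing.IsLieIdealOf (PrimeRing.affineLine a)
            (PrimeRing.centralClosure R).toAddSubgroup := by
  rw [PrimeRing.isExceptional_iff, PrimeRing.forall_isLieIdealOf_affineLine_iff hR,
    PrimeRing.charP_two_and_finrank_unitalClosure_eq_four_iff hR]
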